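/- Let $p$ be a prime and let $\mathbb{Q}_p \subseteq L \subseteq k \subseteq K$ be field extensions, where $L/\mathbb{Q}_p$ is finite, $k$ is an algebraic closure of $L$, and $K$ is a complete non-archimedean field extension of $k$ (with absolute value extending that of $\mathbb{Q}_p$). Let $\mathbb{G}$ be a connected affine group scheme of finite type over $L$, and write $G := \mathbb{G}(k)$. Suppose that $G$ acts morphically on a projective algebraic variety $X$ over $k$ (that is, through an action $(\mathbb{G}\otimes_L k)\times_k X \to X$ of $k$-schemes), and let $Y \subseteq X$ be a Zariski closed subset. Define the intersection obstruction of $Y$ and its core by $$\mathcal{Z}_Y := \{ g \in G : Y \cap gY \neq \emptyset\}, \qquad \mathcal{Z}_Y^\circ := \bigcap_{g \in G} g\,\mathcal{Z}_Y\,g^{-1}.$$ $\mathcal{Z}_Y$ is a Zariski closed subset of $G$; let $\mathcal{Z}_Y(K) \subseteq \mathbb{G}(K)$ denote the set of $K$-points of the corresponding closed subset of $\mathbb{G}\otimes_L k$. Call $x \in \mathbb{G}(K)$ generic if the $L$-algebra homomorphism $x : \mathcal{O}(\mathbb{G}) \to K$ is injective. For a group $H$ acting on a set $S$ and a subset $T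 \subseteq S$, say that the $H$-orbit of $T$ is regular in $S$ if, for all $h \in H$, $hT \cap T \neq \emptyset$ implies $hT = T$. Let $\mathbf{X}$ and $\mathbf{Y} \subseteq \mathbf{X}$ be the rigid analytifications of the base changes of $X$ and $Y$ to $K$; the underlying set of $\mathbf{X}$ is the set of closed points of $X_K$, on which $\mathbb{G}(K)$ acts, and $\mathbf{Y}$ consists of the closed points of $X_K$ lying over $Y$. 1. For every generic $x \in \mathbb{G}(K)$, $$x\,\mathcal{Z}_Y(K)\,x^{-1} \cap \mathbb{G}(L) \subseteq \mathcal{Z}_Y^\circ .$$ 2. If every element of $\mathcal{Z}_Y^\circ \cap \mathbb{G}(L)$ acts trivially on $X$, then for every generic $x \in \mathbb{G}(K)$ the $\mathbb{G}(L)$-orbit of $x\mathbf{Y}$ is regular in $\mathbf{X}$. -/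

import Mathlib

open CategoryTheory AlgebraicGeometry MonoidalCategory CartesianMonoidalCategory
open scoped MonObj Obj Pointwise

universe u

namespace RegOrbit

noncomputable section

/-! ### Schemes over a field and their points -/

section Points

variable (F : Type u) [Field F] (R : Type u) [CommRing R] [Algebra F R]

/-- `Spec R` as a scheme over `Spec F`, for an `F`-algebra `R`. -/
abbrev specOver : Over (Spec (.of F)) :=
  Over.mk (Spec.map (CommRingCat.ofHom (algebraMap F R)))

/-- The set `V(R)` of `R`-valued points of an `F`-scheme `V`. If `V` is a group scheme, this is
a group; if a group scheme `G` acts on `V`, then the group `G(R)` acts on `V(R)`. -/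
abbrev Points (V : Over (Spec (.of F))) : Type u := specOver F R ⟶ V

variable {F R} in
/-- The point of the underlying topological space of `V` at which an `E`-valued point of `V` is
located, for a field `E`. -/
def Points.center {E : Type u} [Field E] [Algebra F E] {V : Over (Spec (.of F))}
    (x : Points F E V) : V.left :=
  x.left (IsLocalRing.closedPoint E)

/-- The map `V(R) → V(S)` induced by `R → S`, as a group homomorphism for a group scheme `V`. -/
def pointsMap (S : Type u) [CommRing S] [Algebra F S] [Algebra R S] [IsScalarTower F R S]
    (V : Over (Spec (.of F))) [GrpObj V] : Points F R V →* Points F S V where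
  toFun x := (Over.homMk (U := specOver F S) (V := specOver F R)
    (Spec.map (CommRingCat.ofHom (algebraMap R S))) (by
      dsimp
      rw [← Spec.map_comp, ← CommRingCat.ofHom_comp, ← IsScalarTower.algebraMap_eq])) ≫ x
  map_one' := MonObj.comp_one _
  map_mul' x y := MonObj.comp_mul _ x y

end Points

/-! ### Base change of group schemes along a field extension -/

section BaseChange

variable (L : Type u) [Field L] (k : Type u) [Field k] [Algebra L k]

/-- The base change `V ⊗_L k` of an `L`-scheme `V`. -/
abbrev baseChange (V : Over (Spec (.of L))) : Over (Spec (.of k)) :=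
  (Over.pullback (Spec.map (CommRingCat.ofHom (algebraMap L k)))).obj V

variable (R : Type u) [CommRing R] [Algebra L R] [Algebra k R] [IsScalarTower L k R]

/-- The canonical `k`-morphism `Spec R → (Spec R) ⊗_L k` for a `k`-algebra `R`. -/
def specToBaseChange : specOver k R ⟶ baseChange L k (specOver L R) :=
  Over.homMk (Limits.pullback.lift (𝟙 _) (Spec.map (CommRingCat.ofHom (algebraMap k R))) (by
    dsimp
    rw [← Spec.map_comp, ← CommRingCat.ofHom_comp, ← IsScalarTower.algebraMap_eq]
    simp)) (Limits.pullback.lift_snd _ _ _)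

/-- The canonical identification `𝔾(R) → (𝔾 ⊗_L k)(R)` for a `k`-algebra `R`. -/
def pointsBaseChange (𝔾 : Over (Spec (.of L))) [GrpObj 𝔾] :
    Points L R 𝔾 →* Points k R (baseChange L k 𝔾) where
  toFun x := specToBaseChange L k R ≫
    (Over.pullback (Spec.map (CommRingCat.ofHom (algebraMap L k)))).map x
  map_one' := by rw [Functor.map_one, MonObj.comp_one]
  map_mul' x y := by rw [Functor.map_mul, MonObj.comp_mul]

/-- The subgroup `𝔾(L)` of `𝔾(R) = (𝔾 ⊗_L k)(R)`. -/
def rationalPoints (𝔾 : Over (Spec (.of L))) [GrpObj 𝔾] :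
    Subgroup (Points k R (baseChange L k 𝔾)) :=
  ((pointsBaseChange L k R 𝔾).comp (pointsMap L L R 𝔾)).range

variable {L R} in
/-- A point `x ∈ 𝔾(R)` is generic if the homomorphism `x : 𝒪(𝔾) → R` is injective. -/
def IsGeneric {𝔾 : Over (Spec (.of L))} (x : Points L R 𝔾) : Prop :=
  Function.Injective x.left.appTop.hom

end BaseChange

/-! ### Projective schemes -/

section Projective

variable (k : Type u) [Field k]

attribute [local instance] MvPolynomial.gradedAlgebra in
/-- The projective space of dimension `n` over `k`. -/
def projectiveSpace (n : ℕ) : Over (Spec (.of k)) :=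
  Over.mk (Proj.toSpecZero (MvPolynomial.homogeneousSubmodule (Fin (n + 1)) k) ≫
    Spec.map (CommRingCat.ofHom
      (algebraMap k (MvPolynomial.homogeneousSubmodule (Fin (n + 1)) k 0))))

variable {k} in
/-- `X` is projective over `k`: it admits a closed immersion over `k` into a projective space. -/
def IsProjective (X : Over (Spec (.of k))) : Prop :=
  ∃ (n : ℕ) (i : X ⟶ projectiveSpace k n), IsClosedImmersion i.left

end Projective

/-! ### Regular orbits -/

/-- The orbit of a subset `Y` of `X` under a group `G` acting on `X` is regular in `X` if distinct
translates of `Y` are disjoint. -/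
def IsRegularOrbit (G : Type*) [Group G] {X : Type*} [MulAction G X] (Y : Set X) : Prop :=
  ∀ g : G, (g • Y ∩ Y).Nonempty → g • Y = Y

/-! ### The intersection obstruction and its core -/

section Obstruction

variable {k : Type u} [Field k] (G : Over (Spec (.of k))) [GrpObj G]
  {X : Over (Spec (.of k))} [ModObj G X]

/-- The set of `k`-points `Y(k) ⊆ X(k)` of a subset `Y` of (the underlying space of) `X`. -/
def rationalPointsIn (Y : Set X.left) : Set (Points k k X) := {P | P.center ∈ Y}

/-- The intersection obstruction `𝒵_Y = {g ∈ G(k) : Y ∩ gY ≠ ∅}`. -/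
def intersectionObstruction (Y : Set X.left) : Set (Points k k G) :=
  {g | (rationalPointsIn Y ∩ g • rationalPointsIn Y).Nonempty}

/-- The core `𝒵_Y° = ⋂_{g ∈ G(k)} g 𝒵_Y g⁻¹` of the intersection obstruction. -/
def core (Y : Set X.left) : Set (Points k k G) :=
  ⋂ g : Points k k G, (fun z => g * z * g⁻¹) '' intersectionObstruction G Y

variable {G} in
/-- The set `Z(K)` of `K`-points of a Zariski closed subset `Z ⊆ G(k)`, for a field extension
`K` of `k`: those `K`-points of `G` that are located on the closed subset of the scheme `G`
which corresponds to `Z`, i.e. on the closure of the set of closed points given by `Z`. -/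
def pointsOfClosed (K : Type u) [Field K] [Algebra k K] (Z : Set (Points k k G)) :
    Set (Points k K G) :=
  {x | x.center ∈ closure (Points.center '' Z)}

end Obstruction

/-! ### Points of the rigid analytification -/

section Analytification

variable {k : Type u} [Field k] (K : Type u) [Field K] [Algebra k K]

/-- The base change `X_K = X ×_{Spec k} Spec K`, regarded as a scheme over `k`. -/
abbrev extend (X : Over (Spec (.of k))) : Over (Spec (.of k)) := X ⊗ specOver k K

variable {G : Over (Spec (.of k))} [GrpObj G] (X : Over (Spec (.of k))) [ModObj G X]

/-- The endomorphism `(x, t) ↦ (g(t) x, t)` of `X_K` given by an element `g` of `G(K)`. -/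
def translate (g : Points k K G) : extend K X ⟶ extend K X :=
  lift ((snd X (specOver k K) ≫ g) • fst X (specOver k K)) (snd X (specOver k K))

lemma translate_one : translate K X (1 : Points k K G) = 𝟙 _ := by
  simp [translate, MonObj.comp_one]

lemma translate_mul (g h : Points k K G) :
    translate K X (g * h) = translate K X h ≫ translate K X g := by
  have h1 : translate K X h ≫ snd X (specOver k K) = snd X (specOver k K) := by simp [translate]
  have h2 : translate K X h ≫ fst X (specOver k K) =
      (snd X (specOver k K) ≫ h) • fst X (specOver k K) := by simp [translate]
  conv_rhs => rw [translate.eq_def K X g, comp_lift, ModObj.comp_smul, reassoc_of% h1, h1, h2, ← mul_smul,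
    ← MonObj.comp_mul]
  rfl

/-- The underlying set of the rigid analytification of `X_K`: the set of closed points of `X_K`
(equivalently, the set of Galois orbits on the points of `X` over an algebraic closure of `K`). -/
def RigidPoints : Type u := {z : (extend K X).left // IsClosed {z}}

instance : MulAction (Points k K G) (RigidPoints K X) where
  smul g z := ⟨(translate K X g).left z.1, by
    have e (w : (extend K X).left) : (translate K X g⁻¹).left ((translate K X g).left w) = w := by
      rw [← Scheme.Hom.comp_apply, ← Over.comp_left, ← translate_mul, inv_mul_cancel,
        translate_one]
      rfl
    have e' (w : (extend K X).left) : (translate K X g).left ((translate K X g⁻¹).left w) = w := by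
      rw [← Scheme.Hom.comp_apply, ← Over.comp_left, ← translate_mul, mul_inv_cancel,
        translate_one]
      rfl
    have : {(translate K X g).left z.1} = (translate K X g⁻¹).left ⁻¹' {z.1} := by
      ext w
      simp only [Set.mem_singleton_iff, Set.mem_preimage]
      exact ⟨fun h => by rw [h, e], fun h => by rw [← h, e']⟩
    rw [this]
    exact z.2.preimage (translate K X g⁻¹).left.continuous⟩
  one_smul z := Subtype.ext <| by
    change (translate K X (1 : Points k K G)).left z.1 = z.1
    rw [translate_one]
    rfl
  mul_smul g h z := Subtype.ext <| by
    change (translate K X (g * h)).left z.1 = (translate K X g).left ((translate K X h).left z.1)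
    rw [translate_mul]
    rfl

variable {X} in
/-- The underlying set of the rigid analytification of `Y_K`, as a subset of that of `X_K`:
the closed points of `X_K` which lie over the closed subset `Y` of `X`. -/
def rigidSubset (Y : Set X.left) : Set (RigidPoints K X) :=
  {z | (fst X (specOver k K)).left z.1 ∈ Y}

end Analytification

end

end RegOrbit

/-!
Write `G` for `𝔾 ⊗_L k`. The proof rests on two facts.

*The obstruction is a projection.* Let `W ⊆ G × X` be the closed set of pairs `(g, y)` with `y ∈ Y`
and `g⁻¹ y ∈ Y`. Its image in `G` is closed because `X` is proper over `k`, and the closed points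
of this image are exactly the elements of `𝒵_Y`, because a nonempty closed subset of a fibre of
`G × X → G` over a `k`-point contains a `k`-point. So the image is the closure of `𝒵_Y`
(`closure_center_image_intersectionObstruction`), and a `K`-point `u` of `G` for which `u 𝐘` meets
`𝐘` lies on it (`mem_pointsOfClosed_of_rigidPoint`).

*A generic `K`-point of `𝔾` is located at the generic point of `G`*
(`IsGeneric.isGenericPoint_center_pointsBaseChange`). Injectivity of `𝒪(𝔾) → K` says that the
point lies over the generic point of `𝔾`, which is thereby irreducible. The projection `G → 𝔾` is
flat and integral, so each irreducible component of `G` surjects onto `𝔾`, hence contains the only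
point above the unit section. By homogeneity each component contains every closed point, so `G` is
irreducible (`irreducibleSpace_baseChange`). By incomparability, the only point of `G` above the
generic point of `𝔾` is the generic point of `G`.

Now let `x` be generic, and let `h ∈ 𝔾(L)` be such that `x⁻¹ h x` lies on the closure of `𝒵_Y`. The
morphism `g ↦ g⁻¹ h g` from `G` to itself is defined over `k` and maps the generic point of `G`
into this closed set, hence it maps all of `G` into it, that is, `h` lies in the core
(`mem_core_of_isGenericPoint`). This is the first claim. For the second one, if `h x 𝐘` meets
`x 𝐘`, then `x⁻¹ h x 𝐘` meets `𝐘`, so `h` is in the core and fixes all `k`-points of `X`. As `X` is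
reduced and separated, `h` acts as the identity morphism on `X` and on `X_K`, so `h x 𝐘 = x 𝐘`.
-/

namespace RegOrbit

/-! ### Points of schemes over a field -/

section Points

variable {F : Type u} [Field F] {E : Type u} [Field E] [Algebra F E]

lemma Points.center_comp {V W : Over (Spec (.of F))} (x : Points F E V) (f : V ⟶ W) :
    Points.center (x ≫ f : Points F E W) = f.left x.center := rfl

lemma Points.left_apply {V : Over (Spec (.of F))} (x : Points F E V) (t : Spec (.of E)) :
    x.left t = x.center := by
  rw [Points.center, Subsingleton.elim t (IsLocalRing.closedPoint E)]

lemma Points.comp_apply {T V : Over (Spec (.of F))} (f : T ⟶ specOver F E) (x : Points F E V)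
    (t : T.left) : (f ≫ x).left t = x.center := by
  rw [Over.comp_left, Scheme.Hom.comp_apply, Points.left_apply]

lemma Points.center_pointsMap {V : Over (Spec (.of F))} [GrpObj V] (x : Points F F V) :
    (pointsMap F F E V x).center = x.center := by
  simp only [pointsMap, MonoidHom.coe_mk, OneHom.coe_mk, Points.center_comp, Points.left_apply]

end Points

section AlgClosed

variable {k : Type u} [Field k] {V : Over (Spec (.of k))}

lemma specOver_self_hom : (specOver k k).hom = 𝟙 (Spec (.of k)) := by
  simp only [Over.mk_hom, Algebra.algebraMap_self]
  exact Spec.map_id _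

lemma Points.left_comp_hom (x : Points k k V) : x.left ≫ V.hom = 𝟙 _ := by
  rw [Over.w x]; exact specOver_self_hom

variable [IsAlgClosed k] [LocallyOfFiniteType V.hom]

lemma Points.center_injective : Function.Injective (Points.center : Points k k V → V.left) := by
  intro x y h
  ext1
  exact ext_of_apply_closedPoint_eq V.hom x.left_comp_hom y.left_comp_hom h

lemma Points.isClosed_center (x : Points k k V) : IsClosed {x.center} :=
  (pointEquivClosedPoint V.hom ⟨x.left, x.left_comp_hom⟩).2

lemma Points.exists_center_eq {v : V.left} (hv : IsClosed {v}) : ∃ x : Points k k V, x.center = v :=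
  ⟨Over.homMk (pointOfClosedPoint V.hom v hv) (by
    rw [pointOfClosedPoint_comp]; exact specOver_self_hom.symm), pointOfClosedPoint_apply V.hom v hv _⟩

lemma Points.range_center :
    Set.range (Points.center : Points k k V → V.left) = closedPoints V.left := by
  ext v
  exact ⟨by rintro ⟨x, rfl⟩; exact x.isClosed_center, Points.exists_center_eq⟩

end AlgClosed

section Projective

variable (k : Type u) [Field k] (n : ℕ)

lemma bijective_algebraMap_homogeneousSubmodule_zero : Function.Bijective
    (algebraMap k (MvPolynomial.homogeneousSubmodule (Fin (n + 1)) k 0)) := by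
  refine ⟨.of_comp (f := Subtype.val) (MvPolynomial.C_injective _ k), fun ⟨f, hf⟩ => ?_⟩
  rw [MvPolynomial.homogeneousSubmodule_zero, Submodule.mem_one] at hf
  obtain ⟨c, hc⟩ := hf
  exact ⟨c, Subtype.ext hc⟩

attribute [local instance] MvPolynomial.gradedAlgebra in
lemma isProper_projectiveSpace : IsProper (projectiveSpace k n).hom := by
  have : IsScalarTower k (MvPolynomial.homogeneousSubmodule (Fin (n + 1)) k 0)
      (MvPolynomial (Fin (n + 1)) k) :=
    ⟨fun a b c => smul_mul_assoc a (b : MvPolynomial (Fin (n + 1)) k) c⟩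
  have : Algebra.FiniteType (MvPolynomial.homogeneousSubmodule (Fin (n + 1)) k 0)
      (MvPolynomial (Fin (n + 1)) k) := .of_restrictScalars_finiteType k _ _
  have : IsIso (CommRingCat.ofHom
      (algebraMap k (MvPolynomial.homogeneousSubmodule (Fin (n + 1)) k 0))) :=
    (ConcreteCategory.isIso_iff_bijective _).2 (bijective_algebraMap_homogeneousSubmodule_zero k n)
  dsimp only [projectiveSpace, Over.mk_hom]
  infer_instance

variable {k} in
lemma IsProjective.isProper {X : Over (Spec (.of k))} (hX : IsProjective X) : IsProper X.hom := by
  obtain ⟨n, i, hi⟩ := hX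
  have := isProper_projectiveSpace k n
  rw [← Over.w i]
  infer_instance

end Projective

/-! ### The intersection obstruction as a projection -/

section Obstruction

variable {k : Type u} [Field k] {G : Over (Spec (.of k))} [GrpObj G]
  {X : Over (Spec (.of k))} [ModObj G X]

variable (G) in
/-- The closed subset `{(g, y) : y ∈ Y, g⁻¹ y ∈ Y}` of the scheme `G × X`. -/
def incidence (Y : Set X.left) : Set (G ⊗ X).left :=
  (snd G X).left ⁻¹' Y ∩ ((fst G X)⁻¹ • snd G X).left ⁻¹' Y

lemma isClosed_incidence {Y : Set X.left} (hY : IsClosed Y) : IsClosed (incidence G Y) :=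
  (hY.preimage (snd G X).left.continuous).inter
    (hY.preimage ((fst G X)⁻¹ • snd G X).left.continuous)

lemma isClosed_image_incidence [IsProper X.hom] {Y : Set X.left} (hY : IsClosed Y) :
    IsClosed ((fst G X).left '' incidence G Y) := by
  have : IsProper (fst G X).left := by dsimp; infer_instance
  exact (fst G X).left.isClosedMap _ (isClosed_incidence hY)

lemma lift_mem_incidence {Y : Set X.left} {T : Over (Spec (.of k))} {u : T ⟶ G} {y : T ⟶ X}
    {t : T.left} : (lift u y).left t ∈ incidence G Y ↔ y.left t ∈ Y ∧ (u⁻¹ • y).left t ∈ Y := by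
  rw [incidence, Set.mem_inter_iff, Set.mem_preimage, Set.mem_preimage,
    ← Scheme.Hom.comp_apply, ← Scheme.Hom.comp_apply, ← Over.comp_left, ← Over.comp_left,
    ModObj.comp_smul, GrpObj.comp_inv, lift_fst, lift_snd]

lemma mem_intersectionObstruction_iff {Y : Set X.left} {g : Points k k G} :
    g ∈ intersectionObstruction G Y ↔
      ∃ P : Points k k X, P.center ∈ Y ∧ (g⁻¹ • P : Points k k X).center ∈ Y := by
  simp [intersectionObstruction, Set.Nonempty, Set.mem_smul_set_iff_inv_smul_mem,
    rationalPointsIn]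

variable [IsAlgClosed k] [LocallyOfFiniteType G.hom]

lemma mem_intersectionObstruction_iff_center_mem [IsProper X.hom] {Y : Set X.left}
    (hY : IsClosed Y) {g : Points k k G} :
    g ∈ intersectionObstruction G Y ↔ g.center ∈ (fst G X).left '' incidence G Y := by
  rw [mem_intersectionObstruction_iff]
  constructor
  · rintro ⟨P, hP, hP'⟩
    exact ⟨Points.center (lift g P : Points k k (G ⊗ X)), lift_mem_incidence.2 ⟨hP, hP'⟩,
      by rw [← Points.center_comp, lift_fst]⟩
  · rintro ⟨w, hw, hwg⟩
    have : LocallyOfFiniteType (G ⊗ X).hom := by dsimp; infer_instance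
    have : JacobsonSpace (G ⊗ X).left :=
      LocallyOfFiniteType.jacobsonSpace (Y := Spec _) (G ⊗ X).hom
    -- The fibre of the incidence set over `g` is a nonempty closed set, so it has a `k`-point.
    have hcl : IsClosed ((fst G X).left ⁻¹' {g.center} ∩ incidence G Y) :=
      (g.isClosed_center.preimage (fst G X).left.continuous).inter (isClosed_incidence hY)
    obtain ⟨v, ⟨hvg, hv⟩, hvc⟩ := nonempty_inter_closedPoints
      (show (_ ∩ _ : Set (G ⊗ X).left).Nonempty from ⟨w, hwg, hw⟩) hcl.isLocallyClosed
    obtain ⟨q, rfl⟩ := Points.exists_center_eq hvc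
    have hq : q ≫ fst G X = g := Points.center_injective hvg
    have hq' : q = lift g (q ≫ snd G X) := by rw [← hq, lift_comp_fst_snd]
    rw [hq'] at hv
    exact ⟨_, lift_mem_incidence.1 hv⟩

lemma closure_center_image_intersectionObstruction [IsProper X.hom] {Y : Set X.left}
    (hY : IsClosed Y) : closure (Points.center '' intersectionObstruction G Y) =
      (fst G X).left '' incidence G Y := by
  have : JacobsonSpace G.left := LocallyOfFiniteType.jacobsonSpace (Y := Spec _) G.hom
  have h : Points.center '' intersectionObstruction G Y =
      (fst G X).left '' incidence G Y ∩ closedPoints G.left := by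
    ext v
    rw [← Points.range_center]
    constructor
    · rintro ⟨g, hg, rfl⟩
      exact ⟨(mem_intersectionObstruction_iff_center_mem hY).1 hg, g, rfl⟩
    · rintro ⟨hv, g, rfl⟩
      exact ⟨g, (mem_intersectionObstruction_iff_center_mem hY).2 hv, rfl⟩
  rw [h, JacobsonSpace.closure_inter_closedPoints_eq_closure
    (isClosed_image_incidence hY).isLocallyClosed, (isClosed_image_incidence hY).closure_eq]

/-- The intersection obstruction is Zariski closed in `G(k)`. -/
lemma mem_intersectionObstruction_of_center_mem_closure [IsProper X.hom] {Y : Set X.left}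
    (hY : IsClosed Y) {g : Points k k G}
    (hg : g.center ∈ closure (Points.center '' intersectionObstruction G Y)) :
    g ∈ intersectionObstruction G Y := by
  rwa [mem_intersectionObstruction_iff_center_mem hY,
    ← closure_center_image_intersectionObstruction hY]

/-- If `u 𝐘` meets `𝐘` in a point `w` of `X_K`, then the morphism `(u, id) : X_K → G × X` sends `w`
to the incidence set, and the first component of its image is the location of `u`. -/
lemma mem_pointsOfClosed_of_rigidPoint {K : Type u} [Field K] [Algebra k K] [IsProper X.hom]
    {Y : Set X.left} (hY : IsClosed Y) {u : Points k K G}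
    (hu : (u • rigidSubset K Y ∩ rigidSubset K Y).Nonempty) :
    u ∈ pointsOfClosed K (intersectionObstruction G Y) := by
  obtain ⟨w, hw, hw'⟩ := hu
  rw [Set.mem_smul_set_iff_inv_smul_mem] at hw
  change _ ∈ closure _
  rw [closure_center_image_intersectionObstruction hY]
  refine ⟨(lift (snd X (specOver k K) ≫ u) (fst X (specOver k K))).left w.1,
    lift_mem_incidence.2 ⟨hw', ?_⟩, ?_⟩
  · have h : translate K X u⁻¹ ≫ fst X (specOver k K) =
      (snd X (specOver k K) ≫ u)⁻¹ • fst X (specOver k K) := by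
      rw [translate, lift_fst, GrpObj.comp_inv]
    rw [← h]
    exact hw
  · rw [← Scheme.Hom.comp_apply, ← Over.comp_left, lift_fst, Points.comp_apply]

end Obstruction

/-! ### Generic points and irreducibility of the base change -/

/-- If the homeomorphisms of a space carry a point `e` to every point of a dense set, and `e` lies
in all irreducible components, then each component contains the dense set, so there is only one. -/
lemma irreducibleSpace_of_homogeneous {T : Type*} [TopologicalSpace T] {S : Set T} (hS : Dense S)
    {e : T} (he : ∀ Z ∈ irreducibleComponents T, e ∈ Z)
    (hom : ∀ s ∈ S, ∃ f : T ≃ₜ T, f e = s) : IrreducibleSpace T := by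
  have hZ := irreducibleComponent_mem_irreducibleComponents e
  have hZS : S ⊆ irreducibleComponent e := by
    intro s hs
    obtain ⟨f, rfl⟩ := hom s hs
    have hne : (irreducibleComponent e ∩ Set.range f).Nonempty :=
      ⟨e, mem_irreducibleComponent, f.surjective e⟩
    exact he _ (preimage_mem_irreducibleComponents hZ f.isOpenEmbedding hne)
  have hZu : irreducibleComponent e = Set.univ := Set.univ_subset_iff.1 <| by
    rw [← hS.closure_eq]
    exact closure_minimal hZS isClosed_irreducibleComponent
  rw [irreducibleSpace_def, Set.top_eq_univ, ← hZu]
  exact isIrreducible_irreducibleComponent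

/-- Incomparability for integral morphisms of affine schemes. -/
lemma eq_of_specializes_of_isIntegralHom {U V : Scheme.{u}} (f : U ⟶ V) [IsAffine U] [IsAffine V]
    [IsIntegralHom f] {a b : U} (h : a ⤳ b) (hf : f a = f b) : a = b := by
  have hint : f.appTop.hom.IsIntegral := f.isIntegral_app ⊤ (isAffineOpen_top V)
  let _ := f.appTop.hom.toAlgebra
  have : Algebra.IsIntegral Γ(V, ⊤) Γ(U, ⊤) := ⟨hint⟩
  have hcomap (c : U) : PrimeSpectrum.comap f.appTop.hom (U.toSpecΓ c) = V.toSpecΓ (f c)  :=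
    congr($(Scheme.toSpecΓ_naturality f) c).symm
  have : (U.toSpecΓ a).asIdeal.IsPrime := PrimeSpectrum.isPrime (U.toSpecΓ a)
  have hle : (U.toSpecΓ a).asIdeal ≤ (U.toSpecΓ b).asIdeal :=
    (PrimeSpectrum.le_iff_specializes _ _).2 (h.map U.toSpecΓ.continuous)
  have heq : (U.toSpecΓ a).asIdeal.comap f.appTop.hom =
      (U.toSpecΓ b).asIdeal.comap f.appTop.hom := by
    have := (hcomap a).trans ((congrArg V.toSpecΓ hf).trans (hcomap b).symm)
    exact congrArg PrimeSpectrum.asIdeal this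
  apply U.toSpecΓ.homeomorph.injective
  by_contra hne
  refine (Ideal.IsIntegral.comap_lt_comap (R := Γ(V, ⊤)) (hle.lt_of_ne fun h' => hne ?_)).ne heq
  exact PrimeSpectrum.ext h'

/-- By going down, the generic point of an irreducible component lies over the generic point of
the base; as the morphism is closed, the component surjects onto the base. -/
lemma image_eq_univ_of_mem_irreducibleComponents {U V : Scheme.{u}} (f : U ⟶ V) [Flat f]
    [IsIntegralHom f] [IrreducibleSpace V] {Z : Set U} (hZ : Z ∈ irreducibleComponents U) :
    f '' Z = Set.univ := by
  have hZc := isClosed_of_mem_irreducibleComponents Z hZ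
  obtain ⟨z, hz⟩ := QuasiSober.sober hZ.1 hZc
  obtain ⟨z', hz', hfz'⟩ := Flat.generalizingMap f (genericPoint_specializes (f z))
  have hzZ : z' ∈ Z := by
    have : Z ⊆ closure {z'} := by
      rw [← hz.def]
      exact closure_minimal (Set.singleton_subset_iff.2 hz'.mem_closure) isClosed_closure
    exact hZ.2 isIrreducible_singleton.closure this (subset_closure rfl)
  refine Set.univ_subset_iff.1 ?_
  rw [← (genericPoint_spec V).def]
  exact closure_minimal (Set.singleton_subset_iff.2 ⟨z', hzZ, hfz'⟩) (f.isClosedMap _ hZc)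

section BaseChange

variable (L : Type u) [Field L] (k : Type u) [Field k] [Algebra L k]

/-- The projection `V ⊗_L k → V`. -/
noncomputable abbrev baseChangeProj (V : Over (Spec (.of L))) : (baseChange L k V).left ⟶ V.left :=
  Limits.pullback.fst V.hom (Spec.map (CommRingCat.ofHom (algebraMap L k)))

instance (V : Over (Spec (.of L))) [Algebra.IsAlgebraic L k] :
    IsIntegralHom (baseChangeProj L k V) := by
  have : IsIntegralHom (Spec.map (CommRingCat.ofHom (algebraMap L k))) :=
    IsIntegralHom.SpecMap_iff.2 (algebraMap_isIntegral_iff.2 inferInstance)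
  infer_instance

instance (V : Over (Spec (.of L))) [LocallyOfFiniteType V.hom] :
    LocallyOfFiniteType (baseChange L k V).hom := by
  dsimp; infer_instance

instance (V : Over (Spec (.of L))) [IsAffine V.left] : IsAffine (baseChange L k V).left := by
  dsimp; infer_instance

/-- There is only one point of `V ⊗_L k` over an `L`-rational point of `V`: the fibre product of
`Spec L` and `V ⊗_L k` over `V` is `Spec k`. -/
lemma subsingleton_preimage_baseChangeProj {V : Over (Spec (.of L))} (x : Points L L V) :
    ((baseChangeProj L k V) ⁻¹' Set.range x.left).Subsingleton := by
  let g := Spec.map (CommRingCat.ofHom (algebraMap L k))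
  have : IsIso (x.left ≫ V.hom) := by rw [x.left_comp_hom]; infer_instance
  have e : Limits.pullback x.left (baseChangeProj L k V) ≅ Spec (.of k) :=
    Limits.pullbackRightPullbackFstIso V.hom g x.left ≪≫ asIso (Limits.pullback.snd _ _)
  have : Subsingleton ↑(Limits.pullback x.left (baseChangeProj L k V)) :=
    e.schemeIsoToHomeo.injective.subsingleton
  rw [← Scheme.Pullback.range_snd]
  exact Set.subsingleton_range _

variable {L k}

section

variable {R : Type u} [CommRing R] [Algebra L R] [Algebra k R] [IsScalarTower L k R]
  {𝔾 : Over (Spec (.of L))} [GrpObj 𝔾]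

lemma left_pointsBaseChange_comp_baseChangeProj (x : Points L R 𝔾) :
    (pointsBaseChange L k R 𝔾 x).left ≫ baseChangeProj L k 𝔾 = x.left := by
  have h₁ : ((Over.pullback (Spec.map (CommRingCat.ofHom (algebraMap L k)))).map x).left ≫
      baseChangeProj L k 𝔾 = baseChangeProj L k (specOver L R) ≫ x.left :=
    Limits.pullback.lift_fst _ _ _
  have h₂ : (specToBaseChange L k R).left ≫ baseChangeProj L k (specOver L R) = 𝟙 _ :=
    Limits.pullback.lift_fst _ _ _
  change (_ ≫ _) ≫ _ = _
  rw [Category.assoc, h₁, reassoc_of% h₂]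

omit [GrpObj 𝔾] [Algebra L R] [IsScalarTower L k R] in
lemma Points.baseChange_ext {x y : Points k R (baseChange L k 𝔾)}
    (h : x.left ≫ baseChangeProj L k 𝔾 = y.left ≫ baseChangeProj L k 𝔾) : x = y := by
  ext1
  exact Limits.pullback.hom_ext h ((Over.w x).trans (Over.w y).symm)

/-- The two ways to regard an `L`-point of `𝔾` as an `R`-point of `𝔾 ⊗_L k` agree. -/
lemma pointsBaseChange_pointsMap (h : Points L L 𝔾) :
    pointsBaseChange L k R 𝔾 (pointsMap L L R 𝔾 h) =
      pointsMap k k R (baseChange L k 𝔾) (pointsBaseChange L k k 𝔾 (pointsMap L L k 𝔾 h)) := by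
  apply Points.baseChange_ext
  have h₁ (S : Type u) [CommRing S] [Algebra L S] : (pointsMap L L S 𝔾 h).left =
    Spec.map (CommRingCat.ofHom (algebraMap L S)) ≫ h.left := rfl
  have h₂ (z : Points k k (baseChange L k 𝔾)) : (pointsMap k k R (baseChange L k 𝔾) z).left =
    Spec.map (CommRingCat.ofHom (algebraMap k R)) ≫ z.left := rfl
  rw [left_pointsBaseChange_comp_baseChangeProj, h₂, Category.assoc,
    left_pointsBaseChange_comp_baseChangeProj, h₁, h₁, ← Spec.map_comp_assoc,
    ← CommRingCat.ofHom_comp, ← IsScalarTower.algebraMap_eq]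

end

lemma center_pointsBaseChange {E : Type u} [Field E] [Algebra L E] [Algebra k E]
    [IsScalarTower L k E] {𝔾 : Over (Spec (.of L))} [GrpObj 𝔾] (x : Points L E 𝔾) :
    baseChangeProj L k 𝔾 (pointsBaseChange L k E 𝔾 x).center = x.center :=
  congr($(left_pointsBaseChange_comp_baseChangeProj x) (IsLocalRing.closedPoint E))

end BaseChange

section Translation

variable {k : Type u} [Field k]

lemma subsingleton_hom_specOver_self (T : Over (Spec (.of k))) :
    Subsingleton (T ⟶ specOver k k) := ⟨fun f g => by
  ext1
  have hf := Over.w f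
  have hg := Over.w g
  rw [specOver_self_hom] at hf hg
  exact ((Category.comp_id _).symm.trans hf).trans (((Category.comp_id _).symm.trans hg).symm)⟩

/-- The structure morphism of a `k`-scheme, as a morphism to `Spec k` over `k`. -/
noncomputable def toSpecOver (T : Over (Spec (.of k))) : T ⟶ specOver k k :=
  Over.homMk T.hom (by rw [specOver_self_hom]; exact Category.comp_id _)

lemma comp_toSpecOver {S T : Over (Spec (.of k))} (f : S ⟶ T) :
    f ≫ toSpecOver T = toSpecOver S :=
  (subsingleton_hom_specOver_self S).elim _ _

lemma toSpecOver_comp {G : Over (Spec (.of k))} (g : Points k k G) : toSpecOver (specOver k k) ≫ g = g := by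
  rw [(subsingleton_hom_specOver_self _).elim (toSpecOver _) (𝟙 _), Category.id_comp]

variable {G : Over (Spec (.of k))} [GrpObj G]

lemma pointsMap_eq_toSpecOver_comp {K : Type u} [Field K] [Algebra k K] (g : Points k k G) :
    pointsMap k k K G g = toSpecOver (specOver k K) ≫ g :=
  congrArg (· ≫ g) ((subsingleton_hom_specOver_self _).elim _ _)

/-- Left translation by `g ∈ G(k)`, as an automorphism of the scheme `G`. -/
noncomputable def leftTranslation (g : Points k k G) : G ≅ G where
  hom := (toSpecOver G ≫ g) * 𝟙 G
  inv := (toSpecOver G ≫ g⁻¹) * 𝟙 G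
  hom_inv_id := by
    rw [MonObj.comp_mul, reassoc_of% comp_toSpecOver, GrpObj.comp_inv, Category.comp_id,
      inv_mul_cancel_left]
  inv_hom_id := by
    rw [MonObj.comp_mul, reassoc_of% comp_toSpecOver, GrpObj.comp_inv, Category.comp_id,
      mul_inv_cancel_left]

lemma one_comp_leftTranslation (g : Points k k G) :
    (1 : Points k k G) ≫ (leftTranslation g).hom = g := by
  rw [leftTranslation, MonObj.comp_mul, reassoc_of% comp_toSpecOver, Category.comp_id, mul_one,
    toSpecOver_comp]

end Translation

section Generic

variable {L : Type u} [Field L] {k : Type u} [Field k] [Algebra L k] {𝔾 : Over (Spec (.of L))}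
  {K : Type u} [Field K] [Algebra L K] [Algebra k K] [IsScalarTower L k K]

lemma IsGeneric.isGenericPoint_center [IsAffine 𝔾.left] {x : Points L K 𝔾} (hx : IsGeneric x) :
    IsGenericPoint x.center Set.univ := by
  have : CompactSpace (specOver L K).left := inferInstanceAs (CompactSpace (Spec (.of K)))
  have : IsDominant x.left := isDominant_of_of_appTop_injective hx
  have h : Set.range x.left = {x.center} := by
    ext v
    exact ⟨by rintro ⟨t, rfl⟩; exact x.left_apply t, by rintro rfl; exact ⟨_, rfl⟩⟩
  rw [IsGenericPoint, ← h]
  exact x.left.denseRange.closure_range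

variable [GrpObj 𝔾] [IsAlgClosure L k]

variable (L k 𝔾) in
/-- Every irreducible component of `𝔾 ⊗_L k` contains the unit, since it surjects onto `𝔾` and
there is only one point over the unit of `𝔾`; by homogeneity, every irreducible component
contains all closed points. -/
lemma irreducibleSpace_baseChange [LocallyOfFiniteType 𝔾.hom] [IrreducibleSpace 𝔾.left] :
    IrreducibleSpace (baseChange L k 𝔾).left := by
  have : IsAlgClosed k := IsAlgClosure.isAlgClosed L
  have : Algebra.IsAlgebraic L k := IsAlgClosure.isAlgebraic
  have : JacobsonSpace (baseChange L k 𝔾).left :=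
    LocallyOfFiniteType.jacobsonSpace (Y := Spec _) (baseChange L k 𝔾).hom
  refine irreducibleSpace_of_homogeneous (S := closedPoints _)
    (e := (1 : Points k k (baseChange L k 𝔾)).center) (dense_iff_closure_eq.2 closure_closedPoints) ?_ ?_
  · intro Z hZ
    obtain ⟨q, hqZ, hq⟩ :=
      (image_eq_univ_of_mem_irreducibleComponents (baseChangeProj L k 𝔾) hZ).ge
        (Set.mem_univ (1 : Points L L 𝔾).center)
    have he : baseChangeProj L k 𝔾 (1 : Points k k (baseChange L k 𝔾)).center =
        (1 : Points L L 𝔾).center := by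
      rw [← map_one (pointsBaseChange L k k 𝔾), center_pointsBaseChange,
        ← map_one (pointsMap L L k 𝔾), Points.center_pointsMap]
    have hmem : (1 : Points L L 𝔾).center ∈ Set.range (1 : Points L L 𝔾).left := ⟨_, rfl⟩
    have hqe : q = (1 : Points k k (baseChange L k 𝔾)).center :=
      subsingleton_preimage_baseChangeProj L k (1 : Points L L 𝔾)
        (Set.mem_preimage.2 (hq.symm ▸ hmem)) (Set.mem_preimage.2 (he.symm ▸ hmem))
    exact hqe ▸ hqZ
  · intro s hs
    obtain ⟨g, rfl⟩ := Points.exists_center_eq hs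
    refine ⟨((Over.forget _).mapIso (leftTranslation g)).schemeIsoToHomeo, ?_⟩
    conv_rhs => rw [← one_comp_leftTranslation g, Points.center_comp]
    rfl

/-- A generic point of `𝔾` with values in `K` is located at the generic point of `𝔾 ⊗_L k`. -/
lemma IsGeneric.isGenericPoint_center_pointsBaseChange [IsAffine 𝔾.left] [LocallyOfFiniteType 𝔾.hom]
    {x : Points L K 𝔾} (hx : IsGeneric x) :
    IsGenericPoint (pointsBaseChange L k K 𝔾 x).center Set.univ := by
  have : Algebra.IsAlgebraic L k := IsAlgClosure.isAlgebraic
  have hxc := hx.isGenericPoint_center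
  have : IrreducibleSpace 𝔾.left := by
    rw [irreducibleSpace_def, Set.top_eq_univ, ← hxc.def]
    exact isIrreducible_singleton.closure
  have := irreducibleSpace_baseChange L k 𝔾
  have hη := genericPoint_spec (baseChange L k 𝔾).left
  -- Both points lie over the generic point of `𝔾`, so incomparability applies.
  have hs := hη.specializes (Set.mem_univ (pointsBaseChange L k K 𝔾 x).center)
  rwa [← eq_of_specializes_of_isIntegralHom (baseChangeProj L k 𝔾) hs]
  refine ((hs.map (baseChangeProj L k 𝔾).continuous).antisymm ?_).eq
  rw [center_pointsBaseChange]
  exact hxc.specializes (Set.mem_univ _)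

end Generic

/-! ### Conjugates of rational points, and elements acting trivially -/

section Conjugation

variable {k : Type u} [Field k] {G : Over (Spec (.of k))} [GrpObj G]

/-- The morphism `g ↦ g⁻¹ h g` from `G` to itself, for `h ∈ G(k)`. -/
noncomputable def conjugate (h : Points k k G) : G ⟶ G := (𝟙 G)⁻¹ * (toSpecOver G ≫ h) * 𝟙 G

lemma comp_conjugate {K : Type u} [Field K] [Algebra k K] (h : Points k k G) (x : Points k K G) :
    x ≫ conjugate h = x⁻¹ * pointsMap k k K G h * x := by
  rw [conjugate, MonObj.comp_mul, MonObj.comp_mul, reassoc_of% comp_toSpecOver, GrpObj.comp_inv,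
    Category.comp_id, pointsMap_eq_toSpecOver_comp]

lemma comp_conjugate_self (h g : Points k k G) : g ≫ conjugate h = g⁻¹ * h * g := by
  rw [comp_conjugate, pointsMap_eq_toSpecOver_comp, toSpecOver_comp]

variable {X : Over (Spec (.of k))} [ModObj G X]

/-- If `x` is located at the generic point of `G` and `x⁻¹ h x` lies on the intersection
obstruction, then so does every conjugate of `h`, as `g ↦ g⁻¹ h g` is continuous. -/
lemma mem_core_of_isGenericPoint [IsAlgClosed k] [LocallyOfFiniteType G.hom] [IsProper X.hom]
    {Y : Set X.left} (hY : IsClosed Y) {K : Type u} [Field K] [Algebra k K] {x : Points k K G}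
    (hx : IsGenericPoint x.center Set.univ) {h : Points k k G}
    (hh : x⁻¹ * pointsMap k k K G h * x ∈ pointsOfClosed K (intersectionObstruction G Y)) :
    h ∈ core G Y := by
  have hcl : IsClosed ((conjugate h).left ⁻¹'
      closure (Points.center '' intersectionObstruction G Y)) :=
    isClosed_closure.preimage (conjugate h).left.continuous
  rw [← comp_conjugate] at hh
  refine Set.mem_iInter.2 fun g => ⟨g⁻¹ * h * g, ?_, by group⟩
  apply mem_intersectionObstruction_of_center_mem_closure hY
  rw [← comp_conjugate_self]
  exact (hx.specializes (Set.mem_univ g.center)).mem_closed hcl hh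

end Conjugation

section TrivialAction

variable {k : Type u} [Field k] [IsAlgClosed k] {G : Over (Spec (.of k))} [GrpObj G]
  {X : Over (Spec (.of k))} [ModObj G X]

/-- As `X` is reduced and separated, an element of `G(k)` which fixes all `k`-points of `X` acts
as the identity morphism. -/
lemma smul_id_eq_id [IsProper X.hom] [IsReduced X.left] {h : Points k k G}
    (hh : ∀ P : Points k k X, h • P = P) : (toSpecOver X ≫ h) • 𝟙 X = 𝟙 X := by
  ext1
  have hw (f : X ⟶ X) : f.left ≫ X.hom = X.hom := Over.w f
  have : LocallyOfFiniteType (((toSpecOver X ≫ h) • 𝟙 X : X ⟶ X).left ≫ X.hom) := by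
    rw [hw]; infer_instance
  refine ext_of_apply_eq X.hom Set.univ isClosed_univ.isLocallyClosed dense_univ
    (fun v _ hv => ?_) (by rw [hw, hw])
  obtain ⟨P, rfl⟩ := Points.exists_center_eq hv
  rw [← Points.center_comp, ← Points.center_comp, ModObj.comp_smul, reassoc_of% comp_toSpecOver,
    Category.comp_id, toSpecOver_comp, hh]

lemma pointsMap_smul_rigidPoint [IsProper X.hom] [IsReduced X.left] {h : Points k k G}
    (hh : ∀ P : Points k k X, h • P = P) {K : Type u} [Field K] [Algebra k K]
    (z : RigidPoints K X) : pointsMap k k K G h • z = z := by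
  have : translate K X (pointsMap k k K G h) = 𝟙 _ := by
    have : (snd X (specOver k K) ≫ pointsMap k k K G h) • fst X (specOver k K) =
        fst X (specOver k K) := by
      conv_rhs => rw [← Category.comp_id (fst X (specOver k K)), ← smul_id_eq_id hh]
      rw [ModObj.comp_smul, Category.comp_id, pointsMap_eq_toSpecOver_comp,
        reassoc_of% comp_toSpecOver, reassoc_of% comp_toSpecOver]
    rw [translate, this, lift_fst_snd]
  apply Subtype.ext
  change (translate K X (pointsMap k k K G h)).left z.1 = z.1
  rw [this]
  rfl

end TrivialAction

end RegOrbit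

theorem mainTheorem8
    (p : ℕ) [Fact p.Prime]
    -- the fields `ℚ_p ⊆ L ⊆ k ⊆ K`
    (L : Type u) [Field L] [Algebra ℚ_[p] L] [FiniteDimensional ℚ_[p] L]
    (k : Type u) [Field k] [Algebra L k] [IsAlgClosure L k]
    (K : Type u) [NormedField K] [IsUltrametricDist K] [CompleteSpace K] [NormedAlgebra ℚ_[p] K]
    [Algebra L K] [Algebra k K] [IsScalarTower ℚ_[p] L K] [IsScalarTower L k K]
    -- the connected affine group scheme `𝔾` of finite type over `L`
    (𝔾 : Over (Spec (.of L))) [GrpObj 𝔾] [IsAffine 𝔾.left] [LocallyOfFiniteType 𝔾.hom]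
    [ConnectedSpace 𝔾.left]
    -- the projective variety `X` over `k` with its action of `𝔾 ⊗_L k`
    (X : Over (Spec (.of k))) [IsReduced X.left] (hX : RegOrbit.IsProjective X)
    [ModObj (RegOrbit.baseChange L k 𝔾) X]
    -- the Zariski closed subset `Y` of `X`
    (Y : Set X.left) (hY : IsClosed Y) :
    (∀ x : RegOrbit.Points L K 𝔾, RegOrbit.IsGeneric x →
      (fun z => RegOrbit.pointsBaseChange L k K 𝔾 x * z *
            (RegOrbit.pointsBaseChange L k K 𝔾 x)⁻¹) ''
          RegOrbit.pointsOfClosed K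
            (RegOrbit.intersectionObstruction (RegOrbit.baseChange L k 𝔾) Y) ∩
        RegOrbit.rationalPoints L k K 𝔾 ⊆
      RegOrbit.pointsMap k k K (RegOrbit.baseChange L k 𝔾) ''
        RegOrbit.core (RegOrbit.baseChange L k 𝔾) Y) ∧
    ((∀ h ∈ RegOrbit.core (RegOrbit.baseChange L k 𝔾) Y, h ∈ RegOrbit.rationalPoints L k k 𝔾 →
        ∀ P : RegOrbit.Points k k X, h • P = P) →
      ∀ x : RegOrbit.Points L K 𝔾, RegOrbit.IsGeneric x →
        RegOrbit.IsRegularOrbit (RegOrbit.rationalPoints L k K 𝔾)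
          (RegOrbit.pointsBaseChange L k K 𝔾 x • RegOrbit.rigidSubset K Y)) := by
  have : IsAlgClosed k := IsAlgClosure.isAlgClosed L
  have : IsProper X.hom := hX.isProper
  -- An `L`-point `h` such that `x⁻¹ h x` lies on the obstruction belongs to the core.
  have hcore (x : RegOrbit.Points L K 𝔾) (hx : RegOrbit.IsGeneric x) (h : RegOrbit.Points L L 𝔾)
      (hh : (RegOrbit.pointsBaseChange L k K 𝔾 x)⁻¹ *
          RegOrbit.pointsBaseChange L k K 𝔾 (RegOrbit.pointsMap L L K 𝔾 h) *
            RegOrbit.pointsBaseChange L k K 𝔾 x ∈ RegOrbit.pointsOfClosed K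
              (RegOrbit.intersectionObstruction (RegOrbit.baseChange L k 𝔾) Y)) :
      RegOrbit.pointsBaseChange L k k 𝔾 (RegOrbit.pointsMap L L k 𝔾 h) ∈
        RegOrbit.core (RegOrbit.baseChange L k 𝔾) Y := by
    rw [RegOrbit.pointsBaseChange_pointsMap] at hh
    exact RegOrbit.mem_core_of_isGenericPoint hY hx.isGenericPoint_center_pointsBaseChange hh
  constructor
  · rintro x hx _ ⟨⟨z, hz, rfl⟩, h, hh⟩
    refine ⟨_, hcore x hx h ?_, ?_⟩
    · change RegOrbit.pointsBaseChange L k K 𝔾 (RegOrbit.pointsMap L L K 𝔾 h) = _ at hh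
      rw [hh]
      convert hz using 1
      group
    · rw [← RegOrbit.pointsBaseChange_pointsMap]
      exact hh
  · rintro htriv x hx ⟨_, h, rfl⟩ hne
    rw [Subgroup.smul_def] at hne ⊢
    change Set.Nonempty (RegOrbit.pointsBaseChange L k K 𝔾 (RegOrbit.pointsMap L L K 𝔾 h) •
      (_ : Set (RegOrbit.RigidPoints K X)) ∩ _) at hne
    change RegOrbit.pointsBaseChange L k K 𝔾 (RegOrbit.pointsMap L L K 𝔾 h) • _ = _
    -- Translating by `x⁻¹`, the translate of `Y` by `x⁻¹ h x` meets `Y`.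
    have hu : ((RegOrbit.pointsBaseChange L k K 𝔾 x)⁻¹ *
          RegOrbit.pointsBaseChange L k K 𝔾 (RegOrbit.pointsMap L L K 𝔾 h) *
            RegOrbit.pointsBaseChange L k K 𝔾 x ∈ RegOrbit.pointsOfClosed K
              (RegOrbit.intersectionObstruction (RegOrbit.baseChange L k 𝔾) Y)) := by
      apply RegOrbit.mem_pointsOfClosed_of_rigidPoint hY
      rw [← Set.smul_set_nonempty (a := RegOrbit.pointsBaseChange L k K 𝔾 x), Set.smul_set_inter,
        smul_smul, ← mul_assoc, mul_inv_cancel_left, mul_smul]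
      exact hne
    have hfix := RegOrbit.pointsMap_smul_rigidPoint (K := K) (htriv _ (hcore x hx h hu) ⟨h, rfl⟩)
    rw [RegOrbit.pointsBaseChange_pointsMap]
    ext z
    rw [Set.mem_smul_set_iff_inv_smul_mem, inv_smul_eq_iff.2 (hfix z).symm]
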